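/- Consider a relay link with incremental or non-incremental signalling. In interval $i=0,1,2,\dots$ the source–destination channel is $h(i)\sim\mathcal{CN}(0,d^{-\alpha})$ (circularly symmetric complex Gaussian) and the SNR is $\gamma(i)=P_S|h(i)|^2/\sigma^2$, where $P_S,\sigma^2,d>0$ and $\alpha\in\mathbb R$. The acknowledgement threshold is $\Gamma'=2^{2R_0}-1$, with $R_0>0$, for incremental signalling and $\Gamma'=\infty$ for non-incremental signalling. The harvested energies $X(i)$ are exponential with mean $1/\lambda_1$, $\lambda_1>0$; the initial level $B(0)\ge 0$ and all the $X(i)$ and $h(i)$ are mutually independent. Let $M>0$. Under the incremental on-off policy (IOFP) the energy in the infinite-size buffer satisfies $$B(i+1)=\begin{cases}B(i)-M+X(i) & \text{if }\gamma(i)<\Gamma'\text{ and }B(i)\ge M,\\ B(i)+X(i) & \text{otherwise,}\end{cases}$$ and the relay transmit power (used when a negative acknowledgement, $\gamma(i)<\Gamma'$, occurs) is $P_R(i)=M\bar I(i)/(1/2)=2M\bar I(i)$, where $\bar I(i)=1$ if $B(i)\ge M$ and $\bar I(i)=0$ otherwise, so that $M\bar I(i)$ is the energy spent in the half interval of transmission.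 Put $W_2=\sigma^2d^{\alpha}/P_S$ and $\phi_{inc}=M\lambda_1\left(1-e^{-W_2\Gamma'}\right)$, with $e^{-\infty}=0$, and suppose that $\phi_{inc}\le 1$. Then: 1. $B(i)$ has no limiting distribution, i.e. it does not converge in distribution to a probability law on $\mathbb R$ as $i\to\infty$. 2. The energy $M$ is asymptotically almost always available: $\Pr\{B(i)\ge M\}\to 1$ as $i\to\infty$. 3. The relay transmit power is asymptotically $2M$: $\Pr\{P_R(i)=2M\}\to 1$ as $i\to\infty$. 4. Almost surely, the fraction of the intervals $i<N$ in which $B(i)\ge M$ and $P_R(i)=2M$ tends to $1$ as $N\to\infty$. 5. If $\phi_{inc}<1$, then almost surely $B(i)\ge M$ and $P_R(i)=2M$ for all but finitely many $i$. -/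

import Mathlib

open MeasureTheory ProbabilityTheory Filter Topology

noncomputable section

/-- Incremental signalling (the destination acknowledges a successful first phase) or
non-incremental signalling (it always sends a NACK). -/
inductive Signalling where
  | incremental
  | nonIncremental

/-- The acknowledgement threshold `Γ'_th`: `2 ^ (2 R₀) - 1` for incremental signalling at rate `R₀`,
and `∞` for non-incremental signalling. -/
def ackThreshold (mode : Signalling) (R₀ : ℝ) : EReal :=
  match mode with
  | .incremental => (((2 : ℝ) ^ (2 * R₀) - 1 : ℝ) : EReal)
  | .nonIncremental => ⊤

/-- The circularly symmetric complex Gaussian law with mean `0` and variance `v`: the real and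
imaginary parts are independent centred real Gaussians, each of variance `v / 2`. -/
def complexGaussian (v : ℝ) : Measure ℂ :=
  ((gaussianReal 0 (v / 2).toNNReal).prod (gaussianReal 0 (v / 2).toNNReal)).map
    (fun p : ℝ × ℝ => (⟨p.1, p.2⟩ : ℂ))

/-- The instantaneous link SNR `P |h|² / σ²` for transmit power `P`, channel coefficient `h` and
noise variance `σ²` (the argument `noise`). -/
def linkSNR (P noise : ℝ) (h : ℂ) : ℝ := P * ‖h‖ ^ 2 / noise

/-- `W₂ = σ² d_SD ^ α / P_S`. -/
def rateSD (P_S noise d_SD α : ℝ) : ℝ := noise * d_SD ^ α / P_S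

/-- `φ_inc = M λ₁ (1 - exp (- W₂ Γ'_th))`, with `exp (-∞) = 0`. -/
def phiInc (M lam W₂ : ℝ) (thr : EReal) : ℝ :=
  M * lam * (1 - (EReal.exp (-((W₂ : EReal) * thr))).toReal)

open scoped Classical in
/-- One update of the infinite-size energy buffer under the incremental on-off policy: `b` is the
current level, `x` the harvested energy and `snr` the source-destination SNR of the interval. -/
def iofpStep (M : ℝ) (thr : EReal) (b x snr : ℝ) : ℝ :=
  if thr ≤ (snr : EReal) then b + x
  else if M ≤ b then b - M + x
  else b + x

/-- The buffer level `B(i)` under the incremental on-off policy, with initial level `B₀`, harvested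
energies `X i` and source-destination SNRs `snr i`. -/
def iofpBuffer {Ω : Type*} (M : ℝ) (thr : EReal) (B₀ : Ω → ℝ) (X snr : ℕ → Ω → ℝ) :
    ℕ → Ω → ℝ
  | 0 => B₀
  | i + 1 => fun ω => iofpStep M thr (iofpBuffer M thr B₀ X snr i ω) (X i ω) (snr i ω)

/-- The relay transmit energy `M Ī` at buffer level `b`, where `Ī = 1` if `b ≥ M`, else `Ī = 0`. -/
def relayEnergy (M b : ℝ) : ℝ := M * (if M ≤ b then 1 else 0)

/-- The relay transmit power: the transmit energy over the duration `1 / 2` of a phase. -/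
def relayPower (M b : ℝ) : ℝ := relayEnergy M b / (1 / 2)

/-- The real process `B` has a limiting distribution: the distribution functions `P(B i ≤ x)`
converge, at every continuity point, to the distribution function of a probability measure. -/
def HasLimitingDistribution {Ω : Type*} [MeasurableSpace Ω] (P : Measure Ω)
    (B : ℕ → Ω → ℝ) : Prop :=
  ∃ ν : Measure ℝ, IsProbabilityMeasure ν ∧
    ∀ x : ℝ, ContinuousAt (fun y => ν.real (Set.Iic y)) x →
      Tendsto (fun i => P.real {ω | B i ω ≤ x}) atTop (𝓝 (ν.real (Set.Iic x)))

open scoped Classical in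
/-- The fraction of the indices `i < N` for which `A i` holds. -/
def fractionUpTo (A : ℕ → Prop) (N : ℕ) : ℝ :=
  (((Finset.range N).filter A).card : ℝ) / (N : ℝ)

end

/-! Let ξ(i) be the harvested energy minus M when a negative acknowledgement occurs. These variables
are i.i.d., and an exponential harvest with a Gaussian channel gives them mean (1 - φ)/λ₁ ≥ 0 and
positive variance. The buffer is nonnegative and gains at least ξ(i) in every interval, so it
dominates the walk of the ξ(i) reflected at 0 (`reflectedWalk_le_iofpBuffer`). Everything follows
from the growth of that walk.

By time reversal, the reflected walk at n lies below c with at most the probability that all partial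
sums up to n do. That probability tends to 0 even at zero drift: the central limit theorem gives one
δ > 0 such that any level is exceeded at some time with probability at least δ, so the limit q
satisfies q ≤ (1 - δ)q (`tendsto_measureReal_forall_sum_lt`). Hence the buffer tends to infinity in
probability, which gives the first three claims.

For time averages, restarting the reflected walk at 0 every m steps only lowers it. The visits below
c in successive blocks are then i.i.d., the strong law gives their average, and the average per step
is small for large m by Cesàro (`ae_tendsto_lowCount_div`). Under strictly positive drift, the
strong law sends the walk itself to infinity. -/

/-! ### Deterministic facts on reflected walks -/

/-- The partial sums of `x` reflected at `0`, started at `0`. -/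
def reflectedWalk (x : ℕ → ℝ) : ℕ → ℝ
  | 0 => 0
  | n + 1 => max (reflectedWalk x n + x n) 0

lemma reflectedWalk_nonneg (x : ℕ → ℝ) (n : ℕ) : 0 ≤ reflectedWalk x n := by
  cases n with
  | zero => exact le_rfl
  | succ n => exact le_max_right _ _

lemma sum_le_reflectedWalk (x : ℕ → ℝ) (a k : ℕ) :
    ∑ j ∈ Finset.range k, x (a + j) ≤ reflectedWalk x (a + k) := by
  induction k with
  | zero => simpa using reflectedWalk_nonneg x a
  | succ k ih =>
    rw [Finset.sum_range_succ]
    exact le_trans (add_le_add_left ih _) (le_max_left _ _)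

/-- The reflected recursion is monotone in its state, and the unrestarted walk is already
nonnegative at time `a`. -/
lemma reflectedWalk_shift_le (x : ℕ → ℝ) (a k : ℕ) :
    reflectedWalk (fun j => x (a + j)) k ≤ reflectedWalk x (a + k) := by
  induction k with
  | zero => exact reflectedWalk_nonneg x a
  | succ k ih => exact max_le_max (add_le_add_left ih _) le_rfl

lemma reflectedWalk_congr {x y : ℕ → ℝ} {n : ℕ} (hxy : ∀ j < n, x j = y j) :
    reflectedWalk x n = reflectedWalk y n := by
  induction n with
  | zero => rfl
  | succ n ih =>
    simp only [reflectedWalk]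
    rw [ih fun j hj => hxy j (hj.trans n.lt_succ_self), hxy n n.lt_succ_self]

/-- Minimality of reflection, the form in which the walk is compared with the buffer. -/
lemma reflectedWalk_le_of_add_le {x b : ℕ → ℝ} (h0 : ∀ n, 0 ≤ b n)
    (hstep : ∀ n, b n + x n ≤ b (n + 1)) (n : ℕ) : reflectedWalk x n ≤ b n := by
  induction n with
  | zero => exact h0 0
  | succ n ih => exact max_le (le_trans (by gcongr) (hstep n)) (h0 _)

lemma measurable_reflectedWalk {Ω : Type*} [MeasurableSpace Ω] {ξ : ℕ → Ω → ℝ}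
    (hξ : ∀ i, Measurable (ξ i)) (n : ℕ) :
    Measurable fun ω => reflectedWalk (fun j => ξ j ω) n := by
  induction n with
  | zero => exact measurable_const
  | succ n ih => exact (ih.add (hξ n)).max measurable_const

/-! ### Divergence in probability at nonnegative drift -/

section Walk

variable {Ω : Type*} [MeasurableSpace Ω] {P : Measure Ω} {ξ : ℕ → Ω → ℝ}

lemma identDistrib_reindex (hindep : iIndepFun ξ P)
    (hident : ∀ i, IdentDistrib (ξ i) (ξ 0) P P) {ι : Type*} [Countable ι] {σ τ : ι → ℕ}
    (hσ : σ.Injective) (hτ : τ.Injective) :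
    IdentDistrib (fun ω j => ξ (σ j) ω) (fun ω j => ξ (τ j) ω) P P :=
  IdentDistrib.pi (fun j => (hident (σ j)).trans (hident (τ j)).symm)
    (hindep.precomp hσ) (hindep.precomp hτ)

variable [IsProbabilityMeasure P]

/-- The centred sum exceeds √m with a probability whose lower limit is at least the positive
Gaussian mass of (1, ∞). Half that mass serves as δ for every level, since √m passes any `a` and the
centring m·E is nonnegative. -/
lemma exists_forall_exists_le_measureReal_lt_sum (hindep : iIndepFun ξ P)
    (hident : ∀ i, IdentDistrib (ξ i) (ξ 0) P P) (hL2 : MemLp (ξ 0) 2 P)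
    (hmean : 0 ≤ P[ξ 0]) (hvar : Var[ξ 0; P] ≠ 0) :
    ∃ δ : ℝ, 0 < δ ∧ ∀ a : ℝ, ∃ m : ℕ, δ ≤ P.real {ω | a < ∑ j ∈ Finset.range m, ξ j ω} := by
  set v := Var[ξ 0; P].toNNReal with hv
  have hv0 : v ≠ 0 := by
    have := variance_nonneg (ξ 0) P
    simpa [hv, Real.toNNReal_eq_zero] using lt_of_le_of_ne this hvar.symm
  have hclt := tendstoInDistribution_inv_sqrt_mul_sum_sub (P' := gaussianReal 0 v) (Y := id)
    ⟨aemeasurable_id, Measure.map_id⟩ hL2 hindep hident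
  have hlim := ProbabilityMeasure.le_liminf_measure_open_of_tendsto hclt.tendsto
    (isOpen_Ioi (a := (1 : ℝ)))
  simp only [ProbabilityMeasure.coe_mk, Measure.map_id] at hlim
  have hpos : 0 < gaussianReal 0 v (Set.Ioi 1) := by
    rw [pos_iff_ne_zero]
    intro h0
    have := (gaussianReal_absolutelyContinuous' 0 hv0) h0
    simp at this
  set g := gaussianReal 0 v (Set.Ioi 1) with hg
  have hgt : g ≠ ⊤ := measure_ne_top _ _
  have hev := eventually_lt_of_lt_liminf ((ENNReal.half_lt_self hpos.ne' hgt).trans_le hlim)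
  refine ⟨(g / 2).toReal, ENNReal.toReal_pos (ENNReal.half_pos hpos.ne').ne'
    (ENNReal.div_ne_top hgt (by simp)), fun a => ?_⟩
  obtain ⟨m, hm, hma, hm0⟩ := (hev.and ((tendsto_natCast_atTop_atTop.eventually_ge_atTop
    (a ^ 2)).and (eventually_gt_atTop 0))).exists
  refine ⟨m, ENNReal.toReal_mono (measure_ne_top _ _) (hm.le.trans ?_)⟩
  rw [Measure.map_apply_of_aemeasurable (hclt.forall_aemeasurable m) measurableSet_Ioi]
  refine measure_mono fun ω hω => ?_
  simp only [Set.mem_preimage, Set.mem_Ioi, Set.mem_ofPred_eq] at hω ⊢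
  have hs : 0 < √(m : ℝ) := Real.sqrt_pos.2 (by exact_mod_cast hm0)
  rw [inv_mul_eq_div, lt_div_iff₀ hs, one_mul] at hω
  have h1 : a ≤ √(m : ℝ) := Real.le_sqrt_of_sq_le hma
  have h2 : 0 ≤ (m : ℝ) * P[ξ 0] := by positivity
  linarith

lemma tendsto_measureReal_forall_sum_lt (hmeas : ∀ i, Measurable (ξ i)) (hindep : iIndepFun ξ P)
    (hident : ∀ i, IdentDistrib (ξ i) (ξ 0) P P) (hL2 : MemLp (ξ 0) 2 P)
    (hmean : 0 ≤ P[ξ 0]) (hvar : Var[ξ 0; P] ≠ 0) (c : ℝ) :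
    Tendsto (fun n => P.real {ω | ∀ k ≤ n, ∑ j ∈ Finset.range k, ξ j ω < c}) atTop (𝓝 0) := by
  obtain ⟨δ, hδ, hsum⟩ := exists_forall_exists_le_measureReal_lt_sum hindep hident hL2 hmean hvar
  set S : ℕ → Ω → ℝ := fun k ω => ∑ j ∈ Finset.range k, ξ j ω with hS
  have hSm : ∀ k, Measurable (S k) := fun k => Finset.measurable_fun_sum _ fun j _ => hmeas j
  set E : ℕ → Set Ω := fun n => {ω | ∀ k ≤ n, S k ω < c} with hE
  have hEm : ∀ n, MeasurableSet (E n) := fun n => by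
    simp only [hE, Set.ofPred_forall]
    exact MeasurableSet.iInter fun k => MeasurableSet.iInter fun _ =>
      measurableSet_lt (hSm k) measurable_const
  have hanti : Antitone E := fun a b hab ω hω k hk => hω k (hk.trans hab)
  have hlim : Tendsto (fun n => P.real (E n)) atTop (𝓝 (P.real (⋂ n, E n))) :=
    (ENNReal.tendsto_toReal (measure_ne_top _ _)).comp
      (tendsto_measure_iInter_atTop (fun n => (hEm n).nullMeasurableSet) hanti
        ⟨0, measure_ne_top _ _⟩)
  set q := P.real (⋂ n, E n) with hq
  have hkey : ∀ n, q ≤ (1 - δ) * P.real (E n) := by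
    intro n
    refine le_of_forall_pos_le_add fun ε hε => ?_
    -- Outside an event of probability below ε the sum at n exceeds `K`; staying below `c` at n + m
    -- then forces the next m increments, independent of `E n`, to sum to at most c - K.
    obtain ⟨K, hK⟩ : ∃ K : ℝ, P.real {ω | S n ω ≤ K} < ε := by
      have h1 : Tendsto (fun K : ℝ => cdf (P.map (S n)) K) atBot (𝓝 0) := tendsto_cdf_atBot _
      obtain ⟨K, hK⟩ := (h1.eventually_lt_const hε).exists
      have := Measure.isProbabilityMeasure_map (μ := P) (hSm n).aemeasurable
      rw [cdf_eq_real, map_measureReal_apply (hSm n) measurableSet_Iic] at hK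
      exact ⟨K, hK⟩
    obtain ⟨m, hm⟩ := hsum (c - K)
    set T : Ω → ℝ := fun ω => ∑ j ∈ Finset.range m, ξ (n + j) ω with hT
    have hTm : Measurable T := Finset.measurable_fun_sum _ fun j _ => hmeas _
    have hTδ : δ ≤ P.real {ω | c - K < T ω} := by
      have hid := (identDistrib_reindex hindep hident
        (σ := fun j : Fin m => n + (j : ℕ)) (τ := fun j : Fin m => (j : ℕ))
        (fun a b hab => Fin.ext (by simpa using hab)) Fin.val_injective).comp
        (u := fun v : Fin m → ℝ => ∑ j, v j) (by fun_prop)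
      have := hid.measure_mem_eq (measurableSet_Ioi (a := c - K))
      have h2 : P {ω | c - K < T ω} = P {ω | c - K < ∑ j ∈ Finset.range m, ξ j ω} := by
        simpa [Function.comp_def, Set.preimage, hT, Finset.sum_range] using this
      rw [measureReal_def, h2]
      exact hm
    have hTc : P.real {ω | T ω ≤ c - K} ≤ 1 - δ := by
      have h3 := probReal_compl_eq_one_sub (μ := P)
        (measurableSet_lt (measurable_const (a := c - K)) hTm)
      have h4 : {ω | c - K < T ω}ᶜ = {ω | T ω ≤ c - K} := by ext; simp
      rw [h4] at h3
      linarith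
    have hind : P.real (E n ∩ {ω | T ω ≤ c - K}) = P.real (E n) * P.real {ω | T ω ≤ c - K} := by
      have hdis : Disjoint (Finset.range n) (Finset.Ico n (n + m)) := by
        rw [Finset.disjoint_left]
        intro a ha hb
        simp only [Finset.mem_range, Finset.mem_Ico] at ha hb
        omega
      have hI := hindep.indepFun_finset _ _ hdis hmeas
      -- The default 0 is never read, because j < k ≤ n.
      have hm1 : MeasurableSet {v : Finset.range n → ℝ | ∀ k ≤ n,
          ∑ j ∈ Finset.range k, (if hj : j ∈ Finset.range n then v ⟨j, hj⟩ else 0) < c} := by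
        simp only [Set.ofPred_forall]
        refine MeasurableSet.iInter fun k => MeasurableSet.iInter fun _ =>
          measurableSet_lt (Finset.measurable_fun_sum _ fun j _ => ?_) measurable_const
        split_ifs with hj
        · exact measurable_pi_apply _
        · exact measurable_const
      have hm2 : MeasurableSet {v : Finset.Ico n (n + m) → ℝ |
          ∑ j ∈ (Finset.range m).attach, v ⟨n + j.1, Finset.mem_Ico.2
            ⟨Nat.le_add_right _ _, Nat.add_lt_add_left (Finset.mem_range.1 j.2) n⟩⟩ ≤ c - K} :=
        measurableSet_le (Finset.measurable_fun_sum _ fun j _ => measurable_pi_apply _)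
          measurable_const
      have := hI.measure_inter_preimage_eq_mul _ _ hm1 hm2
      have e1 : (fun ω (i : Finset.range n) => ξ i ω) ⁻¹' {v : Finset.range n → ℝ | ∀ k ≤ n,
          ∑ j ∈ Finset.range k, (if hj : j ∈ Finset.range n then v ⟨j, hj⟩ else 0) < c} = E n := by
        ext ω
        simp only [Set.mem_preimage, Set.mem_ofPred_eq, hE, hS]
        refine forall₂_congr fun k hk => ?_
        rw [Finset.sum_congr rfl fun j hj => dif_pos (Finset.mem_range.2
          ((Finset.mem_range.1 hj).trans_le hk))]
      have e2 : (fun ω (i : Finset.Ico n (n + m)) => ξ i ω) ⁻¹' {v : Finset.Ico n (n + m) → ℝ |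
          ∑ j ∈ (Finset.range m).attach, v ⟨n + j.1, Finset.mem_Ico.2
            ⟨Nat.le_add_right _ _, Nat.add_lt_add_left (Finset.mem_range.1 j.2) n⟩⟩ ≤ c - K} =
          {ω | T ω ≤ c - K} := by
        ext ω
        simp only [Set.mem_preimage, Set.mem_ofPred_eq, hT]
        rw [Finset.sum_attach (Finset.range m) (fun j => ξ (n + j) ω)]
      rw [e1, e2] at this
      simp only [measureReal_def, this, ENNReal.toReal_mul]
    have hsub : (⋂ n, E n) ⊆ (E n ∩ {ω | T ω ≤ c - K}) ∪ {ω | S n ω ≤ K} := by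
      intro ω hω
      rw [Set.mem_iInter] at hω
      by_cases hSK : S n ω ≤ K
      · exact Or.inr hSK
      · refine Or.inl ⟨hω n, ?_⟩
        have h5 := hω (n + m) (n + m) le_rfl
        simp only [hS, Finset.sum_range_add] at h5
        simp only [hS, not_le] at hSK
        simp only [Set.mem_ofPred_eq, hT]
        linarith
    calc q ≤ P.real ((E n ∩ {ω | T ω ≤ c - K}) ∪ {ω | S n ω ≤ K}) := measureReal_mono hsub
      _ ≤ P.real (E n ∩ {ω | T ω ≤ c - K}) + P.real {ω | S n ω ≤ K} := measureReal_union_le _ _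
      _ ≤ (1 - δ) * P.real (E n) + ε := by
        rw [hind, mul_comm]
        gcongr
  have hq0 : q ≤ (1 - δ) * q := ge_of_tendsto' (hlim.const_mul (1 - δ)) hkey
  have : q = 0 := le_antisymm (by nlinarith) measureReal_nonneg
  rwa [this] at hlim

/-- The reflected walk at n dominates every sum of the last k ≤ n increments; reversing their order
turns these into initial partial sums without changing the joint law. -/
lemma tendsto_measureReal_reflectedWalk_lt (hmeas : ∀ i, Measurable (ξ i))
    (hindep : iIndepFun ξ P)
    (hident : ∀ i, IdentDistrib (ξ i) (ξ 0) P P) (hL2 : MemLp (ξ 0) 2 P)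
    (hmean : 0 ≤ P[ξ 0]) (hvar : Var[ξ 0; P] ≠ 0) (c : ℝ) :
    Tendsto (fun n => P.real {ω | reflectedWalk (fun j => ξ j ω) n < c}) atTop (𝓝 0) := by
  refine squeeze_zero (fun _ => measureReal_nonneg) (fun n => ?_)
    (tendsto_measureReal_forall_sum_lt hmeas hindep hident hL2 hmean hvar c)
  have hid := identDistrib_reindex hindep hident
    (σ := fun j : Fin n => n - 1 - (j : ℕ)) (τ := fun j : Fin n => (j : ℕ))
    (fun a b hab => Fin.ext (by simp only at hab; omega)) Fin.val_injective
  have hm : MeasurableSet {v : Fin n → ℝ | ∀ k ≤ n,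
      ∑ j ∈ Finset.range k, (if hj : j < n then v ⟨j, hj⟩ else 0) < c} := by
    simp only [Set.ofPred_forall]
    refine MeasurableSet.iInter fun k => MeasurableSet.iInter fun _ =>
      measurableSet_lt (Finset.measurable_fun_sum _ fun j _ => ?_) measurable_const
    split_ifs with hj
    · exact measurable_pi_apply _
    · exact measurable_const
  have heq := hid.measure_mem_eq hm
  refine ENNReal.toReal_mono (measure_ne_top _ _) ?_
  calc P {ω | reflectedWalk (fun j => ξ j ω) n < c}
      ≤ P ((fun ω (j : Fin n) => ξ (n - 1 - (j : ℕ)) ω) ⁻¹' {v : Fin n → ℝ | ∀ k ≤ n,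
        ∑ j ∈ Finset.range k, (if hj : j < n then v ⟨j, hj⟩ else 0) < c}) := by
        refine measure_mono fun ω hω k hk => lt_of_le_of_lt ?_ hω
        dsimp only
        rw [Finset.sum_congr rfl fun j hj => dif_pos (c := j < n)
          ((Finset.mem_range.1 hj).trans_le hk),
          ← Finset.sum_range_reflect]
        have := sum_le_reflectedWalk (fun j => ξ j ω) (n - k) k
        rw [Nat.sub_add_cancel hk] at this
        refine le_trans (le_of_eq (Finset.sum_congr rfl fun j hj => ?_)) this
        have := Finset.mem_range.1 hj
        congr 1
        omega
    _ = P ((fun ω (j : Fin n) => ξ (j : ℕ) ω) ⁻¹' {v : Fin n → ℝ | ∀ k ≤ n,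
        ∑ j ∈ Finset.range k, (if hj : j < n then v ⟨j, hj⟩ else 0) < c}) := heq
    _ ≤ P {ω | ∀ k ≤ n, ∑ j ∈ Finset.range k, ξ j ω < c} := by
        refine measure_mono fun ω hω k hk => ?_
        have := hω k hk
        dsimp only at this
        rwa [Finset.sum_congr rfl fun j hj => dif_pos (c := j < n)
          ((Finset.mem_range.1 hj).trans_le hk)] at this

end Walk

/-! ### Time spent at low levels, and almost sure growth -/

section Walk

variable {Ω : Type*} [MeasurableSpace Ω] {P : Measure Ω} {ξ : ℕ → Ω → ℝ}

lemma indepFun_blocks (hmeas : ∀ i, Measurable (ξ i)) (hindep : iIndepFun ξ P) {a b m : ℕ}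
    (hab : a + m ≤ b) :
    IndepFun (fun ω (j : Fin m) => ξ (a + j) ω) (fun ω (j : Fin m) => ξ (b + j) ω) P := by
  have hdis : Disjoint (Finset.Ico a (a + m)) (Finset.Ico b (b + m)) := by
    rw [Finset.disjoint_left]
    intro i hi hj
    simp only [Finset.mem_Ico] at hi hj
    omega
  have hmem : ∀ (s : ℕ) (j : Fin m), s + (j : ℕ) ∈ Finset.Ico s (s + m) := fun s j => by
    simp
  exact (hindep.indepFun_finset _ _ hdis hmeas).comp
    (φ := fun v (j : Fin m) => v ⟨a + j, hmem a j⟩)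
    (ψ := fun v (j : Fin m) => v ⟨b + j, hmem b j⟩)
    (measurable_pi_lambda _ fun j => measurable_pi_apply _)
    (measurable_pi_lambda _ fun j => measurable_pi_apply _)

/-- The number of indices `j < m` at which the reflected walk of `x` lies below `c`. -/
noncomputable def lowCount (c : ℝ) (m : ℕ) (x : ℕ → ℝ) : ℝ :=
  ∑ j ∈ Finset.range m, (Set.Iio c).indicator 1 (reflectedWalk x j)

lemma lowCount_congr {c : ℝ} {m : ℕ} {x y : ℕ → ℝ} (hxy : ∀ j < m, x j = y j) :
    lowCount c m x = lowCount c m y := by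
  refine Finset.sum_congr rfl fun j hj => ?_
  rw [reflectedWalk_congr fun i hi => hxy i (hi.trans (Finset.mem_range.1 hj))]

lemma lowCount_nonneg (c : ℝ) (m : ℕ) (x : ℕ → ℝ) : 0 ≤ lowCount c m x :=
  Finset.sum_nonneg fun _ _ => Set.indicator_nonneg (by simp) _

lemma indicator_Iio_antitone (c : ℝ) : Antitone ((Set.Iio c).indicator (1 : ℝ → ℝ)) := by
  intro a b hab
  by_cases hb : b < c
  · rw [Set.indicator_of_mem (show b ∈ Set.Iio c from hb),
      Set.indicator_of_mem (show a ∈ Set.Iio c from hab.trans_lt hb)]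
    rfl
  · rw [Set.indicator_of_notMem (show b ∉ Set.Iio c from hb)]
    exact Set.indicator_nonneg (by simp) _

lemma lowCount_mono_right (c : ℝ) {m n : ℕ} (hmn : m ≤ n) (x : ℕ → ℝ) :
    lowCount c m x ≤ lowCount c n x :=
  Finset.sum_le_sum_of_subset_of_nonneg (Finset.range_mono hmn)
    fun _ _ _ => Set.indicator_nonneg (by simp) _

lemma lowCount_mul_le (c : ℝ) (m K : ℕ) (x : ℕ → ℝ) :
    lowCount c (K * m) x ≤ ∑ k ∈ Finset.range K, lowCount c m (fun j => x (k * m + j)) := by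
  induction K with
  | zero => simp [lowCount]
  | succ K ih =>
    rw [Finset.sum_range_succ, Nat.succ_mul]
    unfold lowCount at ih ⊢
    rw [Finset.sum_range_add]
    gcongr with j
    exact indicator_Iio_antitone c (reflectedWalk_shift_le x (K * m) j)

lemma measurable_lowCount {c : ℝ} {m : ℕ} (hmeas : ∀ i, Measurable (ξ i)) :
    Measurable fun ω => lowCount c m (fun j => ξ j ω) :=
  Finset.measurable_fun_sum _ fun j _ =>
    (measurable_one.indicator measurableSet_Iio).comp (measurable_reflectedWalk hmeas j)

lemma ae_tendsto_reflectedWalk_atTop (hindep : iIndepFun ξ P)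
    (hident : ∀ i, IdentDistrib (ξ i) (ξ 0) P P) (hint : Integrable (ξ 0) P)
    (hmean : 0 < P[ξ 0]) :
    ∀ᵐ ω ∂P, Tendsto (reflectedWalk fun j => ξ j ω) atTop atTop := by
  filter_upwards [strong_law_ae_real ξ hint (fun i j hij => hindep.indepFun hij) hident]
    with ω hω
  refine tendsto_atTop_mono (f := fun n => (∑ i ∈ Finset.range n, ξ i ω) / n * n) (fun n => ?_)
    (hω.pos_mul_atTop hmean tendsto_natCast_atTop_atTop)
  have h1 := sum_le_reflectedWalk (fun j => ξ j ω) 0 n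
  simp only [zero_add] at h1
  rcases eq_or_ne n 0 with rfl | hn
  · simpa using h1
  · rwa [div_mul_cancel₀ _ (by exact_mod_cast hn)]

variable [IsProbabilityMeasure P]

lemma integrable_indicator_reflectedWalk (hmeas : ∀ i, Measurable (ξ i)) (c : ℝ) (j : ℕ) :
    Integrable (fun ω => (Set.Iio c).indicator (1 : ℝ → ℝ)
      (reflectedWalk (fun j => ξ j ω) j)) P :=
  (integrable_const (1 : ℝ)).indicator
    (measurableSet_lt (measurable_reflectedWalk hmeas j) measurable_const)

lemma integrable_lowCount (hmeas : ∀ i, Measurable (ξ i)) (c : ℝ) (m : ℕ) :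
    Integrable (fun ω => lowCount c m (fun j => ξ j ω)) P :=
  integrable_finsetSum _ fun j _ => integrable_indicator_reflectedWalk hmeas c j

lemma integral_lowCount (hmeas : ∀ i, Measurable (ξ i)) (c : ℝ) (m : ℕ) :
    ∫ ω, lowCount c m (fun j => ξ j ω) ∂P =
      ∑ j ∈ Finset.range m, P.real {ω | reflectedWalk (fun j => ξ j ω) j < c} := by
  unfold lowCount
  rw [integral_finsetSum _ fun j _ => integrable_indicator_reflectedWalk hmeas c j]
  refine Finset.sum_congr rfl fun j _ => ?_
  exact integral_indicator_one (measurableSet_lt (measurable_reflectedWalk hmeas j)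
    measurable_const)

/-- Counts from disjoint blocks are the same function of independent, identically distributed
tuples, so the strong law applies. -/
lemma ae_tendsto_sum_lowCount_div (hmeas : ∀ i, Measurable (ξ i)) (hindep : iIndepFun ξ P)
    (hident : ∀ i, IdentDistrib (ξ i) (ξ 0) P P) (c : ℝ) (m : ℕ) :
    ∀ᵐ ω ∂P, Tendsto (fun K : ℕ =>
      (∑ k ∈ Finset.range K, lowCount c m (fun j => ξ (k * m + j) ω)) / K) atTop
      (𝓝 (∑ j ∈ Finset.range m, P.real {ω | reflectedWalk (fun j => ξ j ω) j < c})) := by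
  set g : (Fin m → ℝ) → ℝ := fun v => lowCount c m fun j => if hj : j < m then v ⟨j, hj⟩ else 0
    with hg
  have hgm : Measurable g := by
    refine measurable_lowCount (ξ := fun j (v : Fin m → ℝ) => if hj : j < m then v ⟨j, hj⟩ else 0)
      fun i => ?_
    split_ifs with hj
    · exact measurable_pi_apply _
    · exact measurable_const
  have hgξ : ∀ (a : ℕ) (ω : Ω), g (fun j => ξ (a + j) ω) = lowCount c m fun j => ξ (a + j) ω :=
    fun a ω => lowCount_congr fun j hj => by simp [hj]
  have h := strong_law_ae_real (μ := P)
    (fun k ω => lowCount c m fun j => ξ (k * m + j) ω)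
    (integrable_lowCount (fun i => hmeas _) c m) ?_ fun k => ?_
  · have h0 := integral_lowCount (P := P) (ξ := fun j => ξ (0 * m + j)) (fun i => hmeas _) c m
    simp only [h0] at h
    simpa using h
  · have hlt : ∀ k l : ℕ, k < l → IndepFun (fun ω => lowCount c m fun j => ξ (k * m + j) ω)
        (fun ω => lowCount c m fun j => ξ (l * m + j) ω) P := by
      intro k l hkl
      have hb : k * m + m ≤ l * m := by
        rw [← Nat.succ_mul]
        exact Nat.mul_le_mul_right m hkl
      simpa only [Function.comp_def, hgξ] using (indepFun_blocks hmeas hindep hb).comp hgm hgm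
    intro k l hkl
    rcases lt_or_gt_of_ne hkl with hkl | hkl
    · exact hlt k l hkl
    · exact (hlt l k hkl).symm
  · have := (identDistrib_reindex hindep hident
      (σ := fun j : Fin m => k * m + (j : ℕ)) (τ := fun j : Fin m => 0 * m + (j : ℕ))
      (fun a b hab => Fin.ext (by simpa using hab))
      (fun a b hab => Fin.ext (by simpa using hab))).comp hgm
    simpa only [Function.comp_def, hgξ] using this

lemma ae_tendsto_lowCount_div (hmeas : ∀ i, Measurable (ξ i)) (hindep : iIndepFun ξ P)
    (hident : ∀ i, IdentDistrib (ξ i) (ξ 0) P P) (hL2 : MemLp (ξ 0) 2 P)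
    (hmean : 0 ≤ P[ξ 0]) (hvar : Var[ξ 0; P] ≠ 0) (c : ℝ) :
    ∀ᵐ ω ∂P, Tendsto (fun N : ℕ => lowCount c N (fun j => ξ j ω) / N) atTop (𝓝 0) := by
  filter_upwards [ae_all_iff.2 fun m => ae_tendsto_sum_lowCount_div hmeas hindep hident c m]
    with ω hω
  have hces := (tendsto_measureReal_reflectedWalk_lt hmeas hindep hident hL2 hmean hvar c).cesaro
  rw [tendsto_order]
  refine ⟨fun a ha => Eventually.of_forall fun N => ha.trans_le
    (div_nonneg (lowCount_nonneg _ _ _) N.cast_nonneg), fun ε hε => ?_⟩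
  obtain ⟨m, hm, hm0⟩ := ((hces.eventually_lt_const hε).and (eventually_gt_atTop 0)).exists
  have hm0' : (0 : ℝ) < m := by exact_mod_cast hm0
  set z := ∑ j ∈ Finset.range m, P.real {ω | reflectedWalk (fun j => ξ j ω) j < c} with hz
  have hK : Tendsto (fun N : ℕ => N / m + 1) atTop atTop :=
    tendsto_atTop_mono (fun N => Nat.le_succ _) (Nat.tendsto_div_const_atTop hm0.ne')
  -- N/m + 1 blocks, with integer division, cover the first N steps; the last factor bounds the
  -- number of blocks divided by N.
  have h1 : Tendsto (fun N : ℕ => (∑ k ∈ Finset.range (N / m + 1),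
      lowCount c m (fun j => ξ (k * m + j) ω)) / ((N / m + 1 : ℕ) : ℝ) * ((m : ℝ)⁻¹ + (N : ℝ)⁻¹))
      atTop (𝓝 (z * ((m : ℝ)⁻¹ + 0))) :=
    ((hω m).comp hK).mul (tendsto_const_nhds.add tendsto_inv_atTop_nhds_zero_nat)
  have h2 : z * ((m : ℝ)⁻¹ + 0) < ε := by rwa [add_zero, mul_comm]
  filter_upwards [h1.eventually_lt_const h2, eventually_gt_atTop 0] with N hN hN0
  refine lt_of_le_of_lt ?_ hN
  have hN0' : (0 : ℝ) < N := by exact_mod_cast hN0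
  have hNK : N ≤ (N / m + 1) * m := by
    have := Nat.div_add_mod N m
    have := Nat.mod_lt N hm0
    rw [add_mul, one_mul, mul_comm]
    omega
  have h3 : lowCount c N (fun j => ξ j ω) ≤ ∑ k ∈ Finset.range (N / m + 1),
      lowCount c m (fun j => ξ (k * m + j) ω) :=
    (lowCount_mono_right c hNK _).trans (lowCount_mul_le c m _ _)
  have h4 : (N : ℝ)⁻¹ ≤ ((N / m + 1 : ℕ) : ℝ)⁻¹ * ((m : ℝ)⁻¹ + (N : ℝ)⁻¹) := by
    have h5 : ((N / m + 1 : ℕ) : ℝ) ≤ N / m + 1 := by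
      push_cast
      gcongr
      exact Nat.cast_div_le
    have h6 : (0 : ℝ) < ((N / m + 1 : ℕ) : ℝ) := by positivity
    rw [inv_mul_eq_div, le_div_iff₀ h6]
    calc (N : ℝ)⁻¹ * ((N / m + 1 : ℕ) : ℝ) ≤ (N : ℝ)⁻¹ * (N / m + 1) := by gcongr
      _ = (m : ℝ)⁻¹ + (N : ℝ)⁻¹ := by field_simp
  calc lowCount c N (fun j => ξ j ω) / N
      ≤ (∑ k ∈ Finset.range (N / m + 1), lowCount c m (fun j => ξ (k * m + j) ω)) * (N : ℝ)⁻¹ := by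
        rw [div_eq_mul_inv]
        gcongr
    _ ≤ _ := by
        rw [div_mul_eq_mul_div, mul_div_assoc, div_eq_inv_mul]
        exact mul_le_mul_of_nonneg_left h4 (Finset.sum_nonneg fun _ _ => lowCount_nonneg _ _ _)

end Walk

/-! ### Exponential and complex Gaussian laws -/

lemma expMeasure_eq_withDensity_restrict (r : ℝ) :
    expMeasure r = (volume.restrict (Set.Ioi 0)).withDensity
      fun x => ENNReal.ofReal (r * Real.exp (-(r * x))) := by
  rw [← withDensity_indicator measurableSet_Ioi]
  refine withDensity_congr_ae ?_
  filter_upwards [Measure.ae_ne volume (0 : ℝ)] with x hx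
  change exponentialPDF r x = _
  rw [exponentialPDF_eq, Set.indicator_apply]
  by_cases h : 0 ≤ x
  · rw [if_pos h, if_pos (show x ∈ Set.Ioi 0 from lt_of_le_of_ne h hx.symm)]
  · rw [if_neg h, if_neg (fun h' : x ∈ Set.Ioi 0 => h (le_of_lt h'))]
    simp

lemma integrableOn_pow_mul_exp_neg_mul {r : ℝ} (hr : 0 < r) (n : ℕ) :
    IntegrableOn (fun x => x ^ n * Real.exp (-(r * x))) (Set.Ioi 0) := by
  have := integrableOn_rpow_mul_exp_neg_mul_rpow (p := 1) (s := n) (b := r)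
    (by have : (0 : ℝ) ≤ n := n.cast_nonneg
        linarith) one_pos hr
  simpa [neg_mul] using this

lemma memLp_two_id_expMeasure {r : ℝ} (hr : 0 < r) : MemLp id 2 (expMeasure r) := by
  rw [memLp_two_iff_integrable_sq aestronglyMeasurable_id, expMeasure_eq_withDensity_restrict,
    integrable_withDensity_iff_integrable_smul' (by fun_prop) (by simp)]
  refine ((integrableOn_pow_mul_exp_neg_mul hr 2).const_mul r).congr
    (Eventually.of_forall fun x => ?_)
  simp only [id_eq, smul_eq_mul]
  rw [ENNReal.toReal_ofReal (by positivity)]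
  ring

lemma integral_id_expMeasure {r : ℝ} (hr : 0 < r) : ∫ x, x ∂(expMeasure r) = 1 / r := by
  rw [expMeasure_eq_withDensity_restrict,
    integral_withDensity_eq_integral_toReal_smul (by fun_prop) (by simp)]
  have h := Real.integral_rpow_mul_exp_neg_mul_Ioi (a := 2) two_pos hr
  have h2 : ∀ x : ℝ, (ENNReal.ofReal (r * Real.exp (-(r * x)))).toReal • x =
      r * (x ^ ((2 : ℝ) - 1) * Real.exp (-(r * x))) := fun x => by
    rw [ENNReal.toReal_ofReal (by positivity), smul_eq_mul]
    norm_num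
    ring
  simp only [h2]
  rw [integral_const_mul, h, Real.Gamma_two]
  norm_num
  field_simp

lemma expMeasure_singleton (r x : ℝ) : expMeasure r {x} = 0 :=
  withDensity_absolutelyContinuous volume _ (measure_singleton x)

lemma expMeasure_Iio_zero (r : ℝ) : expMeasure r (Set.Iio 0) = 0 := by
  rw [expMeasure_eq_withDensity_restrict]
  refine withDensity_absolutelyContinuous _ _ ?_
  rw [Measure.restrict_apply measurableSet_Iio]
  convert measure_empty (μ := (volume : Measure ℝ))
  ext x
  simp only [Set.mem_inter_iff, Set.mem_Iio, Set.mem_Ioi, Set.mem_empty_iff_false]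
  exact iff_of_false (fun h => lt_asymm h.1 h.2) id

lemma gaussianPDF_mul_gaussianPDF {v : ℝ} (hv : 0 < v) (x y : ℝ) :
    gaussianPDF 0 (v / 2).toNNReal x * gaussianPDF 0 (v / 2).toNNReal y =
      ENNReal.ofReal ((Real.pi * v)⁻¹ * Real.exp (-(x ^ 2 + y ^ 2) / v)) := by
  rw [gaussianPDF, gaussianPDF, ← ENNReal.ofReal_mul (gaussianPDFReal_nonneg _ _ _)]
  congr 1
  simp only [gaussianPDFReal, sub_zero, Real.coe_toNNReal _ (half_pos hv).le]
  have h1 : 2 * Real.pi * (v / 2) = Real.pi * v := by ring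
  have h2 : 2 * (v / 2) = v := by ring
  rw [h1, h2, mul_mul_mul_comm, ← mul_inv, Real.mul_self_sqrt (by positivity), ← Real.exp_add]
  congr 2
  ring

lemma lintegral_Ioo_mul_exp_neg_sq_div {v s : ℝ} (hv : 0 < v) (hs : 0 ≤ s) :
    ∫⁻ r in Set.Ioo 0 s, ENNReal.ofReal (r * ((Real.pi * v)⁻¹ * Real.exp (-r ^ 2 / v))) =
      ENNReal.ofReal ((2 * Real.pi)⁻¹ * (1 - Real.exp (-s ^ 2 / v))) := by
  have hc : Continuous fun r : ℝ => r * ((Real.pi * v)⁻¹ * Real.exp (-r ^ 2 / v)) := by fun_prop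
  rw [← ofReal_integral_eq_lintegral_ofReal
    ((hc.integrableOn_Icc (a := 0) (b := s)).mono_set Set.Ioo_subset_Icc_self)
    ((ae_restrict_iff' measurableSet_Ioo).2 (Eventually.of_forall fun r hr => by
      have := hr.1
      simp only [Pi.zero_apply]
      positivity)), ← integral_Ioc_eq_integral_Ioo, ← intervalIntegral.integral_of_le hs,
    intervalIntegral.integral_eq_sub_of_hasDerivAt
      (f := fun r => -((2 * Real.pi)⁻¹ * Real.exp (-r ^ 2 / v))) ?_ (hc.intervalIntegrable _ _)]
  · congr 1
    simp
    ring
  · intro r _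
    have h1 : HasDerivAt (fun r : ℝ => -r ^ 2 / v) (-(2 * r) / v) r := by
      simpa using ((hasDerivAt_pow 2 r).neg.div_const v)
    convert! (h1.exp.const_mul (2 * Real.pi)⁻¹).neg using 1
    field_simp

/-- In polar coordinates the density is radial, and its Jacobian factor r makes the radial integral
elementary; the angle contributes 2π. -/
lemma complexGaussian_norm_sq_lt {v t : ℝ} (hv : 0 < v) (ht : 0 ≤ t) :
    complexGaussian v {z | ‖z‖ ^ 2 < t} = ENNReal.ofReal (1 - Real.exp (-t / v)) := by
  have hv0 : (v / 2).toNNReal ≠ 0 := by simpa [Real.toNNReal_eq_zero] using hv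
  have hmeas : Measurable fun p : ℝ × ℝ => (⟨p.1, p.2⟩ : ℂ) :=
    Complex.measurableEquivRealProd.symm.measurable
  have hset : MeasurableSet {z : ℂ | ‖z‖ ^ 2 < t} := measurableSet_lt (by fun_prop) (by fun_prop)
  rw [complexGaussian, Measure.map_apply hmeas hset, gaussianReal_of_var_ne_zero _ hv0,
    prod_withDensity (measurable_gaussianPDF _ _) (measurable_gaussianPDF _ _),
    withDensity_apply _ (hmeas hset), ← lintegral_indicator (hmeas hset), ← Measure.volume_eq_prod,
    ← lintegral_comp_polarCoord_symm]
  have hpt : ∀ p ∈ polarCoord.target, ENNReal.ofReal p.1 •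
      ((fun p : ℝ × ℝ => (⟨p.1, p.2⟩ : ℂ)) ⁻¹' {z : ℂ | ‖z‖ ^ 2 < t}).indicator
        (fun z : ℝ × ℝ => gaussianPDF 0 (v / 2).toNNReal z.1 * gaussianPDF 0 (v / 2).toNNReal z.2)
        (polarCoord.symm p) =
      (Set.Iio (√t)).indicator (fun r => ENNReal.ofReal
        (r * ((Real.pi * v)⁻¹ * Real.exp (-r ^ 2 / v)))) p.1 * 1 := by
    rintro ⟨r, θ⟩ hp
    have hr : 0 < r := hp.1
    have hsq : (r * Real.cos θ) ^ 2 + (r * Real.sin θ) ^ 2 = r ^ 2 := by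
      have := Real.sin_sq_add_cos_sq θ
      linear_combination r ^ 2 * this
    have hiff : (r * Real.cos θ, r * Real.sin θ) ∈
        ((fun p : ℝ × ℝ => (⟨p.1, p.2⟩ : ℂ)) ⁻¹' {z : ℂ | ‖z‖ ^ 2 < t}) ↔ r ∈ Set.Iio (√t) := by
      simp only [Set.mem_preimage, Set.mem_ofPred_eq, Set.mem_Iio, Complex.sq_norm,
        Complex.normSq_apply, Real.lt_sqrt hr.le]
      rw [← sq, ← sq, hsq]
    simp only [polarCoord_symm_apply, mul_one, smul_eq_mul]
    by_cases h : r ∈ Set.Iio (√t)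
    · rw [Set.indicator_of_mem (hiff.2 h), Set.indicator_of_mem h, gaussianPDF_mul_gaussianPDF hv, hsq, ← ENNReal.ofReal_mul hr.le]
    · rw [Set.indicator_of_notMem (mt hiff.1 h), Set.indicator_of_notMem h, mul_zero]
  rw [setLIntegral_congr_fun polarCoord.open_target.measurableSet hpt, polarCoord_target,
    Measure.volume_eq_prod, ← Measure.prod_restrict,
    lintegral_prod_mul (g := fun _ => 1)
      (((by fun_prop : Measurable fun r : ℝ => ENNReal.ofReal
        (r * ((Real.pi * v)⁻¹ * Real.exp (-r ^ 2 / v)))).indicator measurableSet_Iio).aemeasurable)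
      aemeasurable_const, lintegral_indicator measurableSet_Iio,
    Measure.restrict_restrict measurableSet_Iio, Set.Iio_inter_Ioi,
    lintegral_Ioo_mul_exp_neg_sq_div hv (Real.sqrt_nonneg t), Real.sq_sqrt ht, setLIntegral_one,
    Real.volume_Ioo, ← ENNReal.ofReal_mul' (by linarith [Real.pi_pos])]
  congr 1
  field_simp
  ring

lemma isProbabilityMeasure_complexGaussian (v : ℝ) :
    IsProbabilityMeasure (complexGaussian v) :=
  Measure.isProbabilityMeasure_map Complex.measurableEquivRealProd.symm.measurable.aemeasurable

lemma measurable_linkSNR (Q noise : ℝ) : Measurable (linkSNR Q noise) := by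
  unfold linkSNR
  fun_prop

lemma measurableSet_nack (Q noise : ℝ) (thr : EReal) :
    MeasurableSet {z : ℂ | ¬ thr ≤ (linkSNR Q noise z : EReal)} :=
  (measurableSet_le measurable_const (measurable_linkSNR Q noise).coe_real_ereal).compl

lemma complexGaussian_real_nack {Q noise d α R : ℝ} (mode : Signalling) (hQ : 0 < Q)
    (hnoise : 0 < noise) (hd : 0 < d) (hR : 0 < R) :
    (complexGaussian (d ^ (-α))).real
        {z | ¬ ackThreshold mode R ≤ (linkSNR Q noise z : EReal)} =
      1 - (EReal.exp (-((rateSD Q noise d α : EReal) * ackThreshold mode R))).toReal := by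
  have hda : 0 < d ^ α := Real.rpow_pos_of_pos hd α
  have hW : 0 < rateSD Q noise d α := by unfold rateSD; positivity
  have := isProbabilityMeasure_complexGaussian (d ^ (-α))
  cases mode with
  | nonIncremental =>
    simp [ackThreshold, EReal.coe_mul_top_of_pos hW]
  | incremental =>
    set g : ℝ := (2 : ℝ) ^ (2 * R) - 1 with hg
    have hg0 : 0 ≤ g := by
      have := Real.one_le_rpow (x := 2) (z := 2 * R) (by norm_num) (by linarith)
      linarith
    have hset : {z : ℂ | ¬ ackThreshold .incremental R ≤ (linkSNR Q noise z : EReal)} =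
        {z : ℂ | ‖z‖ ^ 2 < g * noise / Q} := by
      ext z
      simp only [ackThreshold, Set.mem_ofPred_eq, EReal.coe_le_coe_iff, not_le, linkSNR]
      rw [← hg, div_lt_iff₀ hnoise, lt_div_iff₀ hQ, mul_comm Q]
    rw [hset, measureReal_def, complexGaussian_norm_sq_lt (Real.rpow_pos_of_pos hd _)
      (by positivity)]
    have hexp : -(g * noise / Q) / d ^ (-α) = -(rateSD Q noise d α * g) := by
      rw [rateSD, Real.rpow_neg hd.le]
      field_simp
    have hle : Real.exp (-(rateSD Q noise d α * g)) ≤ 1 :=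
      Real.exp_le_one_iff.2 (neg_nonpos.2 (by positivity))
    simp only [ackThreshold]
    rw [← hg, ← EReal.coe_mul, ← EReal.coe_neg, EReal.exp_coe, hexp,
      ENNReal.toReal_ofReal (Real.exp_pos _).le, ENNReal.toReal_ofReal (by linarith)]

/-! ### The energy buffer and its comparison walk -/

open scoped Classical in
/-- The harvested energy `x` minus the energy requested by the relay at the given SNR. -/
noncomputable def netEnergy (M : ℝ) (thr : EReal) (x snr : ℝ) : ℝ :=
  x - if thr ≤ (snr : EReal) then 0 else M

/-- The net energy charges M at every negative acknowledgement, even when the buffer is too low to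
pay; only then is the inequality possibly strict. -/
lemma add_netEnergy_le_iofpStep {M : ℝ} (hM : 0 ≤ M) (thr : EReal) (b x snr : ℝ) :
    b + netEnergy M thr x snr ≤ iofpStep M thr b x snr := by
  unfold netEnergy iofpStep
  split_ifs <;> linarith

lemma iofpStep_nonneg {M b x : ℝ} (thr : EReal) (snr : ℝ) (hb : 0 ≤ b) (hx : 0 ≤ x) :
    0 ≤ iofpStep M thr b x snr := by
  unfold iofpStep
  split_ifs <;> linarith

lemma relayPower_eq_iff {M : ℝ} (hM : 0 < M) (b : ℝ) : relayPower M b = 2 * M ↔ M ≤ b := by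
  unfold relayPower relayEnergy
  split_ifs with h
  · simp only [h, iff_true]
    ring
  · simp [h, hM.ne']

lemma reflectedWalk_le_iofpBuffer {Ω : Type*} {M : ℝ} (hM : 0 ≤ M) (thr : EReal) {B₀ : Ω → ℝ}
    {X snr : ℕ → Ω → ℝ} {ω : Ω} (hB₀ : 0 ≤ B₀ ω) (hX : ∀ i, 0 ≤ X i ω) (n : ℕ) :
    reflectedWalk (fun i => netEnergy M thr (X i ω) (snr i ω)) n ≤
      iofpBuffer M thr B₀ X snr n ω := by
  refine reflectedWalk_le_of_add_le (b := fun n => iofpBuffer M thr B₀ X snr n ω) (fun n => ?_)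
    (fun n => add_netEnergy_le_iofpStep hM thr _ _ _) n
  induction n with
  | zero => exact hB₀
  | succ n ih => exact iofpStep_nonneg thr _ ih (hX n)

lemma measurable_netEnergy (M Q noise : ℝ) (thr : EReal) :
    Measurable fun p : ℝ × ℂ => netEnergy M thr p.1 (linkSNR Q noise p.2) := by
  classical
  unfold netEnergy
  exact measurable_fst.sub (Measurable.ite
    (measurable_snd (measurableSet_nack Q noise thr).of_compl) measurable_const measurable_const)

/-- A monotone function has countably many discontinuities, so continuity points lie beyond every x;
the limiting distribution function would vanish everywhere, contradicting its limit 1 at +∞. -/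
lemma not_hasLimitingDistribution {Ω : Type*} [MeasurableSpace Ω] {P : Measure Ω}
    {B : ℕ → Ω → ℝ} (hB : ∀ x, Tendsto (fun i => P.real {ω | B i ω ≤ x}) atTop (𝓝 0)) :
    ¬ HasLimitingDistribution P B := by
  rintro ⟨ν, hν, hlim⟩
  have hmono : Monotone fun y => ν.real (Set.Iic y) := fun a b hab =>
    measureReal_mono (Set.Iic_subset_Iic.2 hab)
  have hdense : Dense {x | ¬ ContinuousAt (fun y => ν.real (Set.Iic y)) x}ᶜ :=
    hmono.countable_not_continuousAt.dense_compl ℝ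
  have hzero : ∀ x, ν.real (Set.Iic x) = 0 := by
    intro x
    obtain ⟨y, hy, hxy⟩ := hdense.exists_gt x
    have hy0 := tendsto_nhds_unique (hlim y (not_not.1 hy)) (hB y)
    exact le_antisymm (hy0 ▸ hmono hxy.le) measureReal_nonneg
  have h1 := tendsto_cdf_atTop ν
  replace h1 := h1.congr fun x => (cdf_eq_real ν x).trans (hzero x)
  exact zero_ne_one (tendsto_nhds_unique tendsto_const_nhds h1)

lemma tendsto_fractionUpTo_of_lowCount {A : ℕ → Prop} {c : ℝ} {x : ℕ → ℝ}
    (hA : ∀ i, c ≤ reflectedWalk x i → A i)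
    (hx : Tendsto (fun N : ℕ => lowCount c N x / N) atTop (𝓝 0)) :
    Tendsto (fractionUpTo A) atTop (𝓝 1) := by
  classical
  have hlow : Tendsto (fun N : ℕ => 1 - lowCount c N x / N) atTop (𝓝 1) := by
    simpa using hx.const_sub 1
  refine tendsto_of_tendsto_of_tendsto_of_le_of_le' hlow tendsto_const_nhds ?_ ?_
  · filter_upwards [eventually_gt_atTop 0] with N hN
    have hN' : (0 : ℝ) < N := by exact_mod_cast hN
    have hcard : (N : ℝ) ≤ (((Finset.range N).filter A).card : ℝ) + lowCount c N x := by
      rw [Finset.card_filter, lowCount]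
      push_cast
      rw [← Finset.sum_add_distrib]
      calc (N : ℝ) = ∑ j ∈ Finset.range N, (1 : ℝ) := by simp
        _ ≤ _ := Finset.sum_le_sum fun j _ => by
          by_cases hj : reflectedWalk x j < c
          · rw [Set.indicator_of_mem (show _ ∈ Set.Iio c from hj)]
            split_ifs <;> simp
          · rw [if_pos (hA j (not_lt.1 hj))]
            exact le_add_of_nonneg_right (Set.indicator_nonneg (by simp) _)
    have hf : fractionUpTo A N = (((Finset.range N).filter A).card : ℝ) / N := by
      unfold fractionUpTo
      congr!
    rw [hf, sub_le_iff_le_add, ← add_div, one_le_div hN']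
    exact hcard
  · refine Eventually.of_forall fun N => div_le_one_of_le₀ ?_ N.cast_nonneg
    exact_mod_cast (Finset.card_filter_le _ _).trans_eq (Finset.card_range N)

/-! ### The main theorem -/

theorem theorem3
    {Ω : Type*} [MeasurableSpace Ω] (P : Measure Ω) [IsProbabilityMeasure P]
    -- drawn energy, harvesting rate, source power, noise variance, distance, path loss, rate
    (M lam P_S noise d_SD α R₀ : ℝ) (mode : Signalling)
    (hM : 0 < M) (hlam : 0 < lam) (hP_S : 0 < P_S) (hnoise : 0 < noise) (hd : 0 < d_SD)
    (hR₀ : 0 < R₀)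
    -- initial buffer level, harvested energies, source-destination channels
    (B₀ : Ω → ℝ) (X : ℕ → Ω → ℝ) (h : ℕ → Ω → ℂ)
    (hB₀_meas : Measurable B₀) (hX_meas : ∀ i, Measurable (X i)) (hh_meas : ∀ i, Measurable (h i))
    (hB₀_nonneg : ∀ᵐ ω ∂P, 0 ≤ B₀ ω)
    (hX_law : ∀ i, P.map (X i) = expMeasure lam)
    (hh_law : ∀ i, P.map (h i) = complexGaussian (d_SD ^ (-α)))
    -- everything is independent: over the intervals, within an interval, of the initial level
    (hindep : iIndepFun (fun i ω => (X i ω, h i ω)) P)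
    (hXh : ∀ i, IndepFun (X i) (h i) P)
    (hB₀_indep : IndepFun B₀ (fun ω i => (X i ω, h i ω)) P)
    (B : ℕ → Ω → ℝ)
    (hB : B = iofpBuffer M (ackThreshold mode R₀) B₀ X (fun i ω => linkSNR P_S noise (h i ω)))
    (hphi : phiInc M lam (rateSD P_S noise d_SD α) (ackThreshold mode R₀) ≤ 1) :
    ¬ HasLimitingDistribution P B ∧
    Tendsto (fun i => P.real {ω | M ≤ B i ω}) atTop (𝓝 1) ∧
    Tendsto (fun i => P.real {ω | relayPower M (B i ω) = 2 * M}) atTop (𝓝 1) ∧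
    (∀ᵐ ω ∂P, Tendsto
      (fractionUpTo (fun i => M ≤ B i ω ∧ relayPower M (B i ω) = 2 * M)) atTop (𝓝 1)) ∧
    (phiInc M lam (rateSD P_S noise d_SD α) (ackThreshold mode R₀) < 1 →
      ∀ᵐ ω ∂P, ∀ᶠ i in atTop, M ≤ B i ω ∧ relayPower M (B i ω) = 2 * M) := by
  set thr := ackThreshold mode R₀ with hthr
  set ξ : ℕ → Ω → ℝ := fun i ω => netEnergy M thr (X i ω) (linkSNR P_S noise (h i ω)) with hξ
  have hpair : ∀ i, Measurable fun ω => (X i ω, h i ω) := fun i => (hX_meas i).prodMk (hh_meas i)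
  have hf := measurable_netEnergy M P_S noise thr
  have hmeas : ∀ i, Measurable (ξ i) := fun i => hf.comp (hpair i)
  have hiid : iIndepFun ξ P := hindep.comp (fun _ p => netEnergy M thr p.1 (linkSNR P_S noise p.2))
    fun _ => hf
  have hident : ∀ i, IdentDistrib (ξ i) (ξ 0) P P := by
    intro i
    refine IdentDistrib.comp (f := fun ω => (X i ω, h i ω)) (g := fun ω => (X 0 ω, h 0 ω))
      ⟨(hpair i).aemeasurable, (hpair 0).aemeasurable, ?_⟩ hf
    rw [(indepFun_iff_map_prod_eq_prod_map_map (hX_meas i).aemeasurable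
      (hh_meas i).aemeasurable).1 (hXh i), (indepFun_iff_map_prod_eq_prod_map_map
      (hX_meas 0).aemeasurable (hh_meas 0).aemeasurable).1 (hXh 0), hX_law, hX_law, hh_law, hh_law]
  -- the first two moments of the net energy
  set nack : Set ℂ := {z | ¬ thr ≤ (linkSNR P_S noise z : EReal)} with hnack
  have hnack_meas : MeasurableSet nack := measurableSet_nack P_S noise thr
  set Y : Ω → ℝ := fun ω => nack.indicator (fun _ => M) (h 0 ω) with hY
  have hξ0 : ξ 0 = X 0 - Y := by
    ext ω
    simp only [hξ, netEnergy, hY, hnack, Pi.sub_apply, Set.indicator_apply, Set.mem_ofPred_eq,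
      ite_not]
  have hY_meas : Measurable Y := (measurable_const.indicator hnack_meas).comp (hh_meas 0)
  have hX2 : MemLp (X 0) 2 P := by
    have := (memLp_map_measure_iff (p := 2) (μ := P) (f := X 0) (g := id)
      aestronglyMeasurable_id (hX_meas 0).aemeasurable).1
    rw [hX_law] at this
    exact this (memLp_two_id_expMeasure hlam)
  have hY2 : MemLp Y 2 P := by
    refine MemLp.of_bound hY_meas.aestronglyMeasurable M (Eventually.of_forall fun ω => ?_)
    simp only [hY, Set.indicator_apply]
    split_ifs <;> simp [abs_of_pos hM, hM.le]
  have hL2 : MemLp (ξ 0) 2 P := hξ0 ▸ hX2.sub hY2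
  have hEX : P[X 0] = 1 / lam := by
    rw [← integral_id_expMeasure hlam, ← hX_law 0]
    exact (integral_map (hX_meas 0).aemeasurable aestronglyMeasurable_id).symm
  have hEY : P[Y] = M * (1 - (EReal.exp (-((rateSD P_S noise d_SD α : EReal) * thr))).toReal) := by
    rw [← complexGaussian_real_nack mode hP_S hnoise hd hR₀, ← hh_law 0,
      map_measureReal_apply (hh_meas 0) hnack_meas, mul_comm, ← smul_eq_mul,
      ← integral_indicator_const M (hh_meas 0 hnack_meas)]
    rfl
  have hE : P[ξ 0] = (1 - phiInc M lam (rateSD P_S noise d_SD α) thr) / lam := by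
    rw [hξ0, integral_sub' (hX2.integrable one_le_two) (hY2.integrable one_le_two), hEX, hEY,
      phiInc]
    field_simp
  have hmean : 0 ≤ P[ξ 0] := by
    rw [hE]
    exact div_nonneg (by linarith) hlam.le
  -- The harvest and the channel are independent, so the variance is at least that of the harvest,
  -- which is positive because an exponential law has no atoms.
  have hvar : Var[ξ 0; P] ≠ 0 := by
    have hXvar : Var[X 0; P] ≠ 0 := by
      intro h0
      have hae := ae_eq_integral_of_variance_eq_zero hX2 h0
      have hone : P (X 0 ⁻¹' {P[X 0]}) = 1 := by
        rw [← measure_univ (μ := P)]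
        refine measure_congr ?_
        filter_upwards [hae] with ω hω
        exact propext (iff_of_true hω trivial)
      rw [← Measure.map_apply (hX_meas 0) (measurableSet_singleton _), hX_law,
        expMeasure_singleton] at hone
      exact zero_ne_one hone
    have hXY : IndepFun (X 0) Y P :=
      (hXh 0).comp measurable_id (measurable_const.indicator hnack_meas)
    rw [hξ0, variance_sub hX2 hY2, hXY.covariance_eq_zero hX2 hY2]
    have h1 := variance_nonneg (X 0) P
    have h2 := variance_nonneg Y P
    have h3 := lt_of_le_of_ne h1 hXvar.symm
    linarith
  -- the buffer dominates the reflected walk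
  have hX_nonneg : ∀ᵐ ω ∂P, ∀ i, 0 ≤ X i ω := by
    refine ae_all_iff.2 fun i => ?_
    have h0 := expMeasure_Iio_zero lam
    rw [← hX_law i, Measure.map_apply (hX_meas i) measurableSet_Iio] at h0
    filter_upwards [measure_eq_zero_iff_ae_notMem.1 h0] with ω hω
    exact not_lt.1 hω
  have hdom : ∀ᵐ ω ∂P, ∀ i, reflectedWalk (fun j => ξ j ω) i ≤ B i ω := by
    filter_upwards [hB₀_nonneg, hX_nonneg] with ω h0 hX0 i
    rw [hB]
    exact reflectedWalk_le_iofpBuffer (snr := fun i ω => linkSNR P_S noise (h i ω))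
      hM.le thr h0 hX0 i
  have hB_meas : ∀ i, Measurable (B i) := by
    intro i
    rw [hB]
    induction i with
    | zero => exact hB₀_meas
    | succ i ih =>
      have hack : MeasurableSet {ω | thr ≤ (linkSNR P_S noise (h i ω) : EReal)} :=
        measurableSet_le measurable_const
          ((measurable_linkSNR P_S noise).comp (hh_meas i)).coe_real_ereal
      exact Measurable.ite hack (ih.add (hX_meas i)) (Measurable.ite
        (measurableSet_le measurable_const ih) ((ih.sub_const M).add (hX_meas i))
        (ih.add (hX_meas i)))
  have hlt : ∀ x, Tendsto (fun i => P.real {ω | B i ω < x}) atTop (𝓝 0) := fun x =>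
    squeeze_zero (fun _ => measureReal_nonneg)
      (fun i => ENNReal.toReal_mono (measure_ne_top _ _) (measure_mono_ae (by
        filter_upwards [hdom] with ω hω hlt
        exact (hω i).trans_lt hlt)))
      (tendsto_measureReal_reflectedWalk_lt hmeas hiid hident hL2 hmean hvar x)
  have hle : Tendsto (fun i => P.real {ω | M ≤ B i ω}) atTop (𝓝 1) := by
    have h1 := (hlt M).const_sub 1
    rw [sub_zero] at h1
    refine h1.congr fun i => ?_
    rw [← probReal_compl_eq_one_sub (measurableSet_lt (hB_meas i) measurable_const)]
    congr 1
    ext ω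
    simp
  refine ⟨not_hasLimitingDistribution fun x => ?_, hle, ?_, ?_, fun hphi_lt => ?_⟩
  · exact squeeze_zero (fun _ => measureReal_nonneg)
      (fun i => measureReal_mono fun ω (hω : B i ω ≤ x) => hω.trans_lt (lt_add_one x))
      (hlt (x + 1))
  · simpa only [relayPower_eq_iff hM] using hle
  · filter_upwards [hdom, ae_tendsto_lowCount_div hmeas hiid hident hL2 hmean hvar M] with ω hω hlow
    exact tendsto_fractionUpTo_of_lowCount
      (fun i hi => ⟨hi.trans (hω i), (relayPower_eq_iff hM _).2 (hi.trans (hω i))⟩) hlow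
  · have hpos : 0 < P[ξ 0] := by
      rw [hE]
      exact div_pos (by linarith) hlam
    filter_upwards [hdom, ae_tendsto_reflectedWalk_atTop hiid hident
      (hL2.integrable one_le_two) hpos] with ω hω hlim
    filter_upwards [hlim.eventually_ge_atTop M] with i hi
    exact ⟨hi.trans (hω i), (relayPower_eq_iff hM _).2 (hi.trans (hω i))⟩
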